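/- **Conventions.** Let $\mathscr A$ be an abelian category and $\mathscr C\subseteq\mathscr A$ an additive subcategory (full, closed under isomorphisms, finite direct sums and containing $0$). A complex is right (left) $\mathscr C$-acyclic if it becomes acyclic under $\mathrm{Hom}(C,-)$ (under $\mathrm{Hom}(-,C)$) for every $C\in\mathscr C$; it is $\mathscr C$-exact if it is exact and right $\mathscr C$-acyclic. A left $\mathscr C$-resolution of $M$ is a right $\mathscr C$-acyclic complex $\cdots\to C_1\to C_0\to M\to 0$ with all $C_i\in\mathscr C$; right $\mathscr C$-coresolutions $0\to M\to C^0\to C^1\to\cdots$ are defined dually, with left $\mathscr C$-acyclicity. A right $\mathscr C$-approximation of $M$ is a morphism $C\to M$ with $C\in\mathscr C$ through which every morphism $C'\to M$ with $C'\in\mathscr C$ factors; left approximations are dual. $\mathscr C$ is contravariantly (covariantly) finite if every object has a right (left) $\mathscr C$-approximation; a contravariantly finite $\mathscr C$ is admissible if all right $\mathscr C$-approximations are epimorphisms. A pair $(\mathscr X,\mathscr Y)$ of additive subcategories of $\mathscr A$ is a *balanced pair* if $\mathscr X$ is contravariantly finite, $\mathscr Y$ is covariantly finite, every object has a left $\mathscr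 X$-resolution whose augmented complex is left $\mathscr Y$-acyclic, and every object has a right $\mathscr Y$-coresolution whose augmented complex is right $\mathscr X$-acyclic. It is *admissible* if $\mathscr X$ is admissible. Let $\mathrm{Ext}^i_{\mathscr X}(M,N)$ be the $i$-th cohomology group of $\mathrm{Hom}(C_\bullet,N)$, where $C_\bullet\to M$ is a left $\mathscr X$-resolution. Let $T^{(I)}$ denote the coproduct of copies of $T$ indexed by a set $I$ (whenever it exists), and let $\mathrm{Add}\,T$ be the class of direct summands of the objects $T^{(I)}$. For $n\ge 0$ and a balanced pair $(\mathscr X,\mathscr Y)$, an object $T$ is *$n$-$\mathscr X$-tilting* if 1. there is an $\mathscr X$-exact sequence $0\to X_n\to\cdots\to X_0\to T\to 0$ with all $X_i\in\mathscr X$; 2. $\mathrm{Ext}^i_{\mathscr X}(T,T^{(I)})=0$ for all $i>0$ and all sets $I$ for which $T^{(I)}$ exists; 3. for every $X\in\mathscr X$ there is an $\mathscr X$-exact sequence $0\to X\to T_0\to\cdots\to T_n\to 0$ with all $T_i\in\mathrm{Add}\,T$. A *recollement* of $\mathscr A$ by abelian categories $\mathscr A'$ and $\mathscr A''$ consists of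 additive functors forming adjoint triples $(i^*,i_*,i^!)$, with $i_*:\mathscr A'\to\mathscr A$, and $(j_!,j^*,j_*)$, with $j^*:\mathscr A\to\mathscr A''$, such that $i_*,j_!,j_*$ are fully faithful and the essential image of $i_*$ is the kernel of $j^*$. The image of a subcategory under a functor means its essential image. **Theorem 4.3.** Let a recollement of $\mathscr A$ by $\mathscr A'$ and $\mathscr A''$ be given, let $(\mathscr X',\mathscr Y')$ and $(\mathscr X'',\mathscr Y'')$ be balanced pairs in $\mathscr A'$ and $\mathscr A''$, and put $$\mathscr X=\{X\in\mathscr A\mid i^*X\in\mathscr X',\ j^*X\in\mathscr X''\},\qquad \mathscr Y=\{Y\in\mathscr A\mid i^!Y\in\mathscr Y',\ j^*Y\in\mathscr Y''\},$$ $$(\mathscr U,\mathscr V)=(j_!j^*\mathscr X,\ j_*j^*\mathscr Y).$$ Suppose that $j_!$ is exact and that $T''$ is $n$-$\mathscr X''$-tilting in $\mathscr A''$. Then $(\mathscr U,\mathscr V)$ is a balanced pair in $\mathscr A$ and $j_!T''$ is $n$-$\mathscr U$-tilting in $\mathscr A$. If moreover $(\mathscr X'',\mathscr Y'')$ is admissible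 and $j^*$ is faithful, then the balanced pair $(\mathscr U,\mathscr V)$ is admissible. -/

import Mathlib

open CategoryTheory Category Limits Opposite

universe w v u v₁ u₁ v₂ u₂ v₃ u₃

noncomputable section

namespace RelTilting

section Subcategories

variable {A : Type u} [Category.{v} A] [Abelian A]

/-- A (full, replete) additive subcategory: closed under isomorphisms, containing zero and
closed under finite direct sums. -/
structure IsAdditiveSubcategory (P : ObjectProperty A) : Prop where
  of_iso : ∀ {M N : A}, (M ≅ N) → P M → P N
  exists_zero : ∃ Z : A, IsZero Z ∧ P Z
  biprod : ∀ {M N : A}, P M → P N → P (M ⊞ N)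

/-- `f : C ⟶ M` is a right `P`-approximation of `M`: `C` lies in `P` and `Hom(C', f)` is
surjective for all `C'` in `P`. -/
def IsRightApprox (P : ObjectProperty A) {C M : A} (f : C ⟶ M) : Prop :=
  P C ∧ ∀ (C' : A), P C' → ∀ g : C' ⟶ M, ∃ h : C' ⟶ C, h ≫ f = g

/-- `f : M ⟶ C` is a left `P`-approximation of `M`. -/
def IsLeftApprox (P : ObjectProperty A) {M C : A} (f : M ⟶ C) : Prop :=
  P C ∧ ∀ (C' : A), P C' → ∀ g : M ⟶ C', ∃ h : C ⟶ C', f ≫ h = g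

/-- Every object has a right `P`-approximation. -/
def ContravariantlyFinite (P : ObjectProperty A) : Prop :=
  ∀ M : A, ∃ (C : A) (f : C ⟶ M), IsRightApprox P f

/-- Every object has a left `P`-approximation. -/
def CovariantlyFinite (P : ObjectProperty A) : Prop :=
  ∀ M : A, ∃ (C : A) (f : M ⟶ C), IsLeftApprox P f

/-- A contravariantly finite subcategory is admissible if each right approximation is an
epimorphism. -/
def IsAdmissible (P : ObjectProperty A) : Prop :=
  ContravariantlyFinite P ∧ ∀ ⦃C M : A⦄ (f : C ⟶ M), IsRightApprox P f → Epi f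

/-- The complex `Hom(C, K)` of abelian groups. -/
abbrev homFrom {ι : Type} {c : ComplexShape ι} (C : A) (K : HomologicalComplex A c) :
    HomologicalComplex AddCommGrpCat.{v} c :=
  ((preadditiveCoyoneda.obj (op C)).mapHomologicalComplex c).obj K

/-- The complex `Hom(K, C)` of abelian groups. -/
abbrev homTo {ι : Type} {c : ComplexShape ι} (K : HomologicalComplex A c) (C : A) :
    HomologicalComplex AddCommGrpCat.{v} c.symm :=
  ((preadditiveYoneda.obj C).mapHomologicalComplex c.symm).obj K.op

/-- `Hom(C, K)` is acyclic for each `C` in `P`. -/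
def RightAcyclic {ι : Type} {c : ComplexShape ι} (P : ObjectProperty A)
    (K : HomologicalComplex A c) : Prop :=
  ∀ C : A, P C → (homFrom C K).Acyclic

/-- `Hom(K, C)` is acyclic for each `C` in `P`. -/
def LeftAcyclic {ι : Type} {c : ComplexShape ι} (P : ObjectProperty A)
    (K : HomologicalComplex A c) : Prop :=
  ∀ C : A, P C → (homTo K C).Acyclic

/-- A `P`-exact sequence: an exact complex that stays exact under `Hom(C, -)` for each `C`
in `P`. -/
def IsRelExact {ι : Type} {c : ComplexShape ι} (P : ObjectProperty A)
    (K : HomologicalComplex A c) : Prop :=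
  K.Acyclic ∧ RightAcyclic P K

/-- A left `P`-resolution `⋯ ⟶ C₁ ⟶ C₀ ⟶ M ⟶ 0` of `M`: all `Cᵢ` lie in `P` and the augmented
complex is acyclic under `Hom(C, -)` for each `C` in `P`. -/
structure LeftResolution (P : ObjectProperty A) (M : A) where
  /-- the deleted resolution `⋯ ⟶ C₁ ⟶ C₀ ⟶ 0` -/
  complex : ChainComplex A ℕ
  /-- the augmentation `C₀ ⟶ M` -/
  ε : complex.X 0 ⟶ M
  d_ε : complex.d 1 0 ≫ ε = 0
  mem : ∀ i, P (complex.X i)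
  rightAcyclic : RightAcyclic P (complex.augment ε d_ε)

/-- The augmented complex `⋯ ⟶ C₁ ⟶ C₀ ⟶ M ⟶ 0`, with `M` in degree `0`. -/
abbrev LeftResolution.augmented {P : ObjectProperty A} {M : A} (R : LeftResolution P M) :
    ChainComplex A ℕ :=
  R.complex.augment R.ε R.d_ε

/-- A right `P`-coresolution `0 ⟶ M ⟶ C⁰ ⟶ C¹ ⟶ ⋯` of `M`: all `Cⁱ` lie in `P` and the
augmented complex is acyclic under `Hom(-, C)` for each `C` in `P`. -/
structure RightCoresolution (P : ObjectProperty A) (M : A) where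
  /-- the deleted coresolution `0 ⟶ C⁰ ⟶ C¹ ⟶ ⋯` -/
  complex : CochainComplex A ℕ
  /-- the coaugmentation `M ⟶ C⁰` -/
  η : M ⟶ complex.X 0
  η_d : η ≫ complex.d 0 1 = 0
  mem : ∀ i, P (complex.X i)
  leftAcyclic : LeftAcyclic P (complex.augment η η_d)

/-- The augmented complex `0 ⟶ M ⟶ C⁰ ⟶ C¹ ⟶ ⋯`, with `M` in degree `0`. -/
abbrev RightCoresolution.augmented {P : ObjectProperty A} {M : A} (R : RightCoresolution P M) :
    CochainComplex A ℕ :=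
  R.complex.augment R.η R.η_d

/-- A balanced pair of additive subcategories. -/
structure IsBalancedPair (X Y : ObjectProperty A) : Prop where
  additive_left : IsAdditiveSubcategory X
  additive_right : IsAdditiveSubcategory Y
  contravariantlyFinite : ContravariantlyFinite X
  covariantlyFinite : CovariantlyFinite Y
  exists_resolution : ∀ M : A, ∃ R : LeftResolution X M, LeftAcyclic Y R.augmented
  exists_coresolution : ∀ N : A, ∃ R : RightCoresolution Y N, RightAcyclic X R.augmented

/-- The `P`-dimension of `M` is at most `n`: there is a `P`-exact sequence
`0 ⟶ Cₙ ⟶ ⋯ ⟶ C₀ ⟶ M ⟶ 0` with all `Cᵢ` in `P`. (For admissible `P`, exactness of the sequence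
follows from its acyclicity under `Hom(C, -)`, `C` in `P`.) -/
def HasRelDimLE (P : ObjectProperty A) (M : A) (n : ℕ) : Prop :=
  ∃ R : LeftResolution P M, R.augmented.Acyclic ∧ ∀ i, n < i → IsZero (R.complex.X i)

/-- The relative extension group of degree `i`, computed from a left `P`-resolution of the
first variable: the `i`-th cohomology group of `Hom(C_•, N)`. -/
def LeftResolution.ext {P : ObjectProperty A} {M : A} (R : LeftResolution P M) (N : A) (i : ℕ) :
    AddCommGrpCat.{v} :=
  (homTo R.complex N).homology i

/-- Vanishing of the relative extension group of degree `i`. Any two left `P`-resolutions of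
`M` are homotopy equivalent, so the group does not depend on the resolution; the vanishing is
required for all of them. (For the first member of a balanced pair resolutions always exist.) -/
def RelExtVanishes (P : ObjectProperty A) (M N : A) (i : ℕ) : Prop :=
  ∀ R : LeftResolution P M, IsZero (R.ext N i)

/-- `K` lies in `Add T`: it is a direct summand of a coproduct `T^(I)` of copies of `T`. -/
def InAdd (T K : A) : Prop :=
  ∃ (I : Type w) (c : Cofan fun _ : I => T) (J : A),
    Nonempty (IsColimit c) ∧ Nonempty (K ⊞ J ≅ c.pt)

/-- `T` is `P`-self-orthogonal: all relative extension groups of positive degree from `T` to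
a coproduct `T^(I)` vanish, for every set `I` (for which the coproduct exists). -/
def IsSelfOrthogonal (P : ObjectProperty A) (T : A) : Prop :=
  ∀ (I : Type w) (c : Cofan fun _ : I => T), Nonempty (IsColimit c) →
    ∀ i : ℕ, 0 < i → RelExtVanishes P T c.pt i

/-- There is a `P`-exact sequence `0 ⟶ M ⟶ T₀ ⟶ ⋯ ⟶ Tₙ ⟶ 0` with all `Tᵢ` in `Add T`. -/
def HasAddCoresolution (P : ObjectProperty A) (T : A) (n : ℕ) (M : A) : Prop :=
  ∃ (L : CochainComplex A ℕ) (η : M ⟶ L.X 0) (h : η ≫ L.d 0 1 = 0),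
    IsRelExact P (L.augment η h) ∧
    (∀ i, i ≤ n → InAdd.{w} T (L.X i)) ∧ ∀ i, n < i → IsZero (L.X i)

/-- `T` is `n`-`P`-tilting. -/
structure IsTilting (P : ObjectProperty A) (n : ℕ) (T : A) : Prop where
  dim_le : HasRelDimLE P T n
  selfOrthogonal : IsSelfOrthogonal.{w} P T
  coresolution : ∀ M : A, P M → HasAddCoresolution.{w} P T n M

end Subcategories

section Recollements

/-- A recollement of the abelian category `A` by the abelian categories `A'` and `A''`. -/
structure Recollement (A' : Type u₁) [Category.{v₁} A'] [Abelian A']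
    (A : Type u₂) [Category.{v₂} A] [Abelian A]
    (A'' : Type u₃) [Category.{v₃} A''] [Abelian A''] where
  /-- `i^*` -/
  iUpperStar : A ⥤ A'
  /-- `i_*` -/
  iLowerStar : A' ⥤ A
  /-- `i^!` -/
  iUpperShriek : A ⥤ A'
  /-- `j_!` -/
  jLowerShriek : A'' ⥤ A
  /-- `j^*` -/
  jUpperStar : A ⥤ A''
  /-- `j_*` -/
  jLowerStar : A'' ⥤ A
  additive_iUpperStar : iUpperStar.Additive
  additive_iLowerStar : iLowerStar.Additive
  additive_iUpperShriek : iUpperShriek.Additive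
  additive_jLowerShriek : jLowerShriek.Additive
  additive_jUpperStar : jUpperStar.Additive
  additive_jLowerStar : jLowerStar.Additive
  /-- `i^*` is left adjoint to `i_*` -/
  adj_i₁ : iUpperStar ⊣ iLowerStar
  /-- `i_*` is left adjoint to `i^!` -/
  adj_i₂ : iLowerStar ⊣ iUpperShriek
  /-- `j_!` is left adjoint to `j^*` -/
  adj_j₁ : jLowerShriek ⊣ jUpperStar
  /-- `j^*` is left adjoint to `j_*` -/
  adj_j₂ : jUpperStar ⊣ jLowerStar
  full_iLowerStar : iLowerStar.Full
  faithful_iLowerStar : iLowerStar.Faithful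
  full_jLowerShriek : jLowerShriek.Full
  faithful_jLowerShriek : jLowerShriek.Faithful
  full_jLowerStar : jLowerStar.Full
  faithful_jLowerStar : jLowerStar.Faithful
  /-- the essential image of `i_*` is the kernel of `j^*` -/
  essImage_iff : ∀ M : A, iLowerStar.essImage M ↔ IsZero (jUpperStar.obj M)

variable {A' : Type u₁} [Category.{v₁} A'] [Abelian A']
  {A : Type u₂} [Category.{v₂} A] [Abelian A]
  {A'' : Type u₃} [Category.{v₃} A''] [Abelian A'']

/-- The subcategory of the objects `M` of `A` with `i^* M` in `X'` and `j^* M` in `X''`. -/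
def Recollement.glueX (R : Recollement A' A A'') (X' : ObjectProperty A')
    (X'' : ObjectProperty A'') : ObjectProperty A :=
  fun M => X' (R.iUpperStar.obj M) ∧ X'' (R.jUpperStar.obj M)

/-- The subcategory of the objects `M` of `A` with `i^! M` in `Y'` and `j^* M` in `Y''`. -/
def Recollement.glueY (R : Recollement A' A A'') (Y' : ObjectProperty A')
    (Y'' : ObjectProperty A'') : ObjectProperty A :=
  fun M => Y' (R.iUpperShriek.obj M) ∧ Y'' (R.jUpperStar.obj M)

/-- The subcategory `j_! j^* X` of `A` (essential images). -/
def Recollement.subU (R : Recollement A' A A'') (X : ObjectProperty A) : ObjectProperty A :=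
  (X.map R.jUpperStar).map R.jLowerShriek

/-- The subcategory `j_* j^* Y` of `A` (essential images). -/
def Recollement.subV (R : Recollement A' A A'') (Y : ObjectProperty A) : ObjectProperty A :=
  (Y.map R.jUpperStar).map R.jLowerStar

end Recollements

end RelTilting

end

noncomputable section

namespace RelTilting

section Acyclicity

variable {A : Type u} [Category.{v} A] [Abelian A] {ι : Type} {c : ComplexShape ι}

lemma homFrom_exactAt_iff (C : A) (K : HomologicalComplex A c) (i : ι) :
    (homFrom C K).ExactAt i ↔ ∀ f : C ⟶ K.X i, f ≫ K.d i (c.next i) = 0 →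
      ∃ g : C ⟶ K.X (c.prev i), g ≫ K.d (c.prev i) i = f := by
  rw [HomologicalComplex.exactAt_iff, ShortComplex.ab_exact_iff]
  rfl

lemma homTo_exactAt_iff (K : HomologicalComplex A c) (C : A) (i : ι) :
    (homTo K C).ExactAt i ↔ ∀ f : K.X i ⟶ C, K.d (c.prev i) i ≫ f = 0 →
      ∃ g : K.X (c.next i) ⟶ C, K.d i (c.next i) ≫ g = f := by
  rw [HomologicalComplex.exactAt_iff, ShortComplex.ab_exact_iff]
  rfl

lemma rightAcyclic_of_iso {P : ObjectProperty A} {K L : HomologicalComplex A c} (e : K ≅ L)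
    (h : RightAcyclic P K) : RightAcyclic P L := fun C hC i =>
  (h C hC i).of_iso (((preadditiveCoyoneda.obj (op C)).mapHomologicalComplex c).mapIso e)

lemma leftAcyclic_of_iso {P : ObjectProperty A} {K L : HomologicalComplex A c} (e : K ≅ L)
    (h : LeftAcyclic P K) : LeftAcyclic P L := fun C hC i =>
  (h C hC i).of_iso (((preadditiveYoneda.obj C).mapHomologicalComplex c.symm).mapIso
    ((HomologicalComplex.opFunctor A c).mapIso e.symm.op))

end Acyclicity

section Adjunction

variable {B : Type u₁} [Category.{v₁} B] [Abelian B] {A : Type u₂} [Category.{v₂} A] [Abelian A]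
  {F : B ⥤ A} {G : A ⥤ B} {ι : Type} {c : ComplexShape ι}

/-- `Hom(F C, -)` is exact at a pair of maps if and only if `Hom(C, G -)` is. -/
lemma forall_exists_lift_iff (adj : F ⊣ G) [G.Additive] (C : B) {K₁ K₂ K₃ : A}
    (a : K₁ ⟶ K₂) (b : K₂ ⟶ K₃) :
    (∀ f : F.obj C ⟶ K₂, f ≫ b = 0 → ∃ g : F.obj C ⟶ K₁, g ≫ a = f) ↔
      ∀ f : C ⟶ G.obj K₂, f ≫ G.map b = 0 → ∃ g : C ⟶ G.obj K₁, g ≫ G.map a = f := by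
  have hzero : ∀ f : F.obj C ⟶ K₂, f ≫ b = 0 ↔ adj.homEquiv _ _ f ≫ G.map b = 0 := fun f => by
    rw [← adj.homEquiv_naturality_right, ← (adj.homEquiv _ _).apply_eq_iff_eq]
    simp [Adjunction.homEquiv_unit]
  rw [← (adj.homEquiv C K₂).forall_congr_right]
  refine forall_congr' fun f => imp_congr (hzero f) ?_
  rw [← (adj.homEquiv C K₁).exists_congr_right]
  simp only [← adj.homEquiv_naturality_right, EmbeddingLike.apply_eq_iff_eq]

/-- `Hom(F -, C)` is exact at a pair of maps if and only if `Hom(-, G C)` is. -/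
lemma forall_exists_desc_iff (adj : F ⊣ G) [F.Additive] (C : A) {K₁ K₂ K₃ : B}
    (a : K₁ ⟶ K₂) (b : K₂ ⟶ K₃) :
    (∀ f : K₂ ⟶ G.obj C, a ≫ f = 0 → ∃ g : K₃ ⟶ G.obj C, b ≫ g = f) ↔
      ∀ f : F.obj K₂ ⟶ C, F.map a ≫ f = 0 → ∃ g : F.obj K₃ ⟶ C, F.map b ≫ g = f := by
  have hzero : ∀ f : F.obj K₂ ⟶ C, a ≫ adj.homEquiv _ _ f = 0 ↔ F.map a ≫ f = 0 := fun f => by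
    rw [← adj.homEquiv_naturality_left, ← Equiv.eq_symm_apply]
    simp [Adjunction.homEquiv_counit]
  rw [← (adj.homEquiv K₂ C).forall_congr_right]
  refine forall_congr' fun f => imp_congr (hzero f) ?_
  rw [← (adj.homEquiv K₃ C).exists_congr_right]
  simp only [← adj.homEquiv_naturality_left, EmbeddingLike.apply_eq_iff_eq]

lemma homFrom_acyclic_of_iso {C C' : A} (e : C ≅ C') {K : HomologicalComplex A c}
    (h : (homFrom C K).Acyclic) : (homFrom C' K).Acyclic := fun i =>
  (h i).of_iso
    ((NatIso.mapHomologicalComplex (preadditiveCoyoneda.mapIso e.symm.op) c).app K)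

lemma homTo_acyclic_of_iso {C C' : A} (e : C ≅ C') {K : HomologicalComplex A c}
    (h : (homTo K C).Acyclic) : (homTo K C').Acyclic := fun i =>
  (h i).of_iso ((NatIso.mapHomologicalComplex (preadditiveYoneda.mapIso e) c.symm).app K.op)

lemma homFrom_map_exactAt_iff (adj : F ⊣ G) [G.Additive] (C : B) (K : HomologicalComplex A c)
    (i : ι) : (homFrom (F.obj C) K).ExactAt i ↔
      (homFrom C ((G.mapHomologicalComplex c).obj K)).ExactAt i := by
  rw [homFrom_exactAt_iff, homFrom_exactAt_iff]
  exact forall_exists_lift_iff adj C _ _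

lemma homTo_map_exactAt_iff (adj : F ⊣ G) [F.Additive] (K : HomologicalComplex B c) (C : A)
    (i : ι) : (homTo K (G.obj C)).ExactAt i ↔
      (homTo ((F.mapHomologicalComplex c).obj K) C).ExactAt i := by
  rw [homTo_exactAt_iff, homTo_exactAt_iff]
  exact forall_exists_desc_iff adj C _ _

/-- Relative acyclicity is transported along an adjunction, in the covariant variable. -/
lemma rightAcyclic_map_iff (adj : F ⊣ G) [G.Additive] (P : ObjectProperty B)
    (K : HomologicalComplex A c) :
    RightAcyclic (P.map F) K ↔ RightAcyclic P ((G.mapHomologicalComplex c).obj K) := by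
  constructor
  · exact fun h C hC i => (homFrom_map_exactAt_iff adj C K i).1 (h _ (P.prop_map_obj F hC) i)
  · rintro h C ⟨D, hD, ⟨e⟩⟩
    exact homFrom_acyclic_of_iso e fun i => (homFrom_map_exactAt_iff adj D K i).2 (h D hD i)

/-- Relative acyclicity is transported along an adjunction, in the contravariant variable. -/
lemma leftAcyclic_map_iff (adj : F ⊣ G) [F.Additive] (P : ObjectProperty A)
    (K : HomologicalComplex B c) :
    LeftAcyclic (P.map G) K ↔ LeftAcyclic P ((F.mapHomologicalComplex c).obj K) := by
  constructor
  · exact fun h C hC i => (homTo_map_exactAt_iff adj K C i).1 (h _ (P.prop_map_obj G hC) i)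
  · rintro h C ⟨D, hD, ⟨e⟩⟩
    exact homTo_acyclic_of_iso e fun i => (homTo_map_exactAt_iff adj K D i).2 (h D hD i)

lemma acyclic_map (F : B ⥤ A) [F.Additive] [PreservesFiniteLimits F] [PreservesFiniteColimits F]
    {K : HomologicalComplex B c} (h : K.Acyclic) :
    ((F.mapHomologicalComplex c).obj K).Acyclic := fun i =>
  (h i).map F

end Adjunction

section Augment

variable {B : Type u₁} [Category.{v₁} B] [Abelian B] {A : Type u₂} [Category.{v₂} A] [Abelian A]

/-- An additive functor carries augmented chain complexes to augmented chain complexes. -/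
def mapAugmentIso (F : B ⥤ A) [F.Additive] {K : ChainComplex B ℕ} {M : B} {ε : K.X 0 ⟶ M}
    {hε : K.d 1 0 ≫ ε = 0} {L : ChainComplex A ℕ} {N : A} {ε' : L.X 0 ⟶ N}
    {hε' : L.d 1 0 ≫ ε' = 0} (e : (F.mapHomologicalComplex _).obj K ≅ L) (e₀ : F.obj M ≅ N)
    (w : F.map ε ≫ e₀.hom = e.hom.f 0 ≫ ε') :
    (F.mapHomologicalComplex _).obj (K.augment ε hε) ≅ L.augment ε' hε' :=
  HomologicalComplex.Hom.isoOfComponents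
    (fun
      | 0 => e₀
      | i + 1 => (HomologicalComplex.eval _ _ i).mapIso e)
    (by
      rintro i j (rfl : j + 1 = i)
      cases j with
      | zero => exact w.symm
      | succ j => exact e.hom.comm (j + 1) j)

/-- An additive functor carries coaugmented cochain complexes to coaugmented cochain complexes. -/
def mapCoaugmentIso (F : B ⥤ A) [F.Additive] {K : CochainComplex B ℕ} {M : B} {η : M ⟶ K.X 0}
    {hη : η ≫ K.d 0 1 = 0} {L : CochainComplex A ℕ} {N : A} {η' : N ⟶ L.X 0}
    {hη' : η' ≫ L.d 0 1 = 0} (e : (F.mapHomologicalComplex _).obj K ≅ L) (e₀ : F.obj M ≅ N)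
    (w : F.map η ≫ e.hom.f 0 = e₀.hom ≫ η') :
    (F.mapHomologicalComplex _).obj (K.augment η hη) ≅ L.augment η' hη' :=
  HomologicalComplex.Hom.isoOfComponents
    (fun
      | 0 => e₀
      | i + 1 => (HomologicalComplex.eval _ _ i).mapIso e)
    (by
      rintro i j (rfl : i + 1 = j)
      cases i with
      | zero => exact w.symm
      | succ i => exact e.hom.comm i (i + 1))

end Augment

section Transport

variable {B : Type u₁} [Category.{v₁} B] [Abelian B] {A : Type u₂} [Category.{v₂} A] [Abelian A]
  {F H : B ⥤ A} {G : A ⥤ B} {ι : Type} {c : ComplexShape ι} {P : ObjectProperty B}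

lemma IsAdditiveSubcategory.map (F : B ⥤ A) [F.Additive] (h : IsAdditiveSubcategory P) :
    IsAdditiveSubcategory (P.map F) where
  of_iso := by
    rintro M N e ⟨D, hD, ⟨e'⟩⟩
    exact ⟨D, hD, ⟨e' ≪≫ e⟩⟩
  exists_zero := by
    obtain ⟨Z, hZ, hP⟩ := h.exists_zero
    exact ⟨F.obj Z, F.map_isZero hZ, P.prop_map_obj F hP⟩
  biprod := by
    rintro M N ⟨D, hD, ⟨e⟩⟩ ⟨D', hD', ⟨e'⟩⟩
    have := preservesBinaryBiproducts_of_preservesBiproducts F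
    exact ⟨D ⊞ D', h.biprod hD hD', ⟨F.mapBiprod D D' ≪≫ biprod.mapIso e e'⟩⟩

omit [Abelian B] [Abelian A] in
lemma ContravariantlyFinite.map (adj : F ⊣ G) (h : ContravariantlyFinite P) :
    ContravariantlyFinite (P.map F) := by
  intro M
  obtain ⟨C, f, hC, hf⟩ := h (G.obj M)
  refine ⟨F.obj C, (adj.homEquiv _ _).symm f, P.prop_map_obj F hC, ?_⟩
  rintro C' ⟨D, hD, ⟨e⟩⟩ g
  obtain ⟨k, hk⟩ := hf D hD (adj.homEquiv _ _ (e.hom ≫ g))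
  refine ⟨e.inv ≫ F.map k, ?_⟩
  rw [assoc, ← adj.homEquiv_naturality_left_symm, hk, Equiv.symm_apply_apply, e.inv_hom_id_assoc]

omit [Abelian B] [Abelian A] in
lemma CovariantlyFinite.map (adj : G ⊣ H) (h : CovariantlyFinite P) :
    CovariantlyFinite (P.map H) := by
  intro M
  obtain ⟨C, f, hC, hf⟩ := h (G.obj M)
  refine ⟨H.obj C, adj.homEquiv _ _ f, P.prop_map_obj H hC, ?_⟩
  rintro C' ⟨D, hD, ⟨e⟩⟩ g
  obtain ⟨k, hk⟩ := hf D hD ((adj.homEquiv _ _).symm (g ≫ e.inv))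
  refine ⟨H.map k ≫ e.hom, ?_⟩
  rw [← assoc, ← adj.homEquiv_naturality_right, hk, Equiv.apply_symm_apply, assoc, e.inv_hom_id,
    comp_id]

/-- If the left adjoint `F` is fully faithful, then `K ≅ G F K` for each complex `K`. -/
def unitMapIso (adj : F ⊣ G) [F.Additive] [G.Additive] [F.Full] [F.Faithful]
    (K : HomologicalComplex B c) :
    (G.mapHomologicalComplex c).obj ((F.mapHomologicalComplex c).obj K) ≅ K :=
  (HomologicalComplex.Hom.isoOfComponents (fun i => (asIso (adj.unit.app (K.X i)) :))
    (fun i j _ => (adj.unit.naturality (K.d i j)).symm)).symm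

/-- If the right adjoint `H` is fully faithful, then `G H K ≅ K` for each complex `K`. -/
def counitMapIso (adj : G ⊣ H) [H.Additive] [G.Additive] [H.Full] [H.Faithful]
    (K : HomologicalComplex B c) :
    (G.mapHomologicalComplex c).obj ((H.mapHomologicalComplex c).obj K) ≅ K :=
  HomologicalComplex.Hom.isoOfComponents (fun i => (asIso (adj.counit.app (K.X i)) :))
    (fun i j _ => (adj.counit.naturality (K.d i j)).symm)

/-- The counit is an isomorphism on complexes with terms in the essential image of `F`. -/
def counitMapIsoOfMem (adj : F ⊣ G) [F.Additive] [G.Additive] [F.Full] [F.Faithful]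
    (K : HomologicalComplex A c) (hK : ∀ i, F.essImage (K.X i)) :
    (F.mapHomologicalComplex c).obj ((G.mapHomologicalComplex c).obj K) ≅ K :=
  HomologicalComplex.Hom.isoOfComponents
    (fun i => @asIso _ _ _ _ (adj.counit.app (K.X i))
      ((Adjunction.isIso_counit_app_iff_mem_essImage adj).2 (hK i)))
    (fun i j _ => (adj.counit.naturality (K.d i j)).symm)

lemma RightAcyclic.map (adj : F ⊣ G) [F.Additive] [G.Additive] [F.Full] [F.Faithful]
    {K : HomologicalComplex B c} (h : RightAcyclic P K) :
    RightAcyclic (P.map F) ((F.mapHomologicalComplex c).obj K) :=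
  (rightAcyclic_map_iff adj P _).2 (rightAcyclic_of_iso (unitMapIso adj K).symm h)

section Resolutions

variable [F.Additive] [G.Additive] [H.Additive]

section

variable [F.Full] [F.Faithful]

omit [G.Additive] [F.Full] [F.Faithful] in
lemma LeftResolution.d_comp_map_ε_comp_counit (adj : F ⊣ G) {M : A}
    (R : LeftResolution P (G.obj M)) :
    ((F.mapHomologicalComplex _).obj R.complex).d 1 0 ≫ F.map R.ε ≫ adj.counit.app M = 0 := by
  have h : F.map (R.complex.d 1 0) ≫ F.map R.ε = 0 := by rw [← F.map_comp, R.d_ε, F.map_zero]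
  exact (assoc _ _ _).symm.trans (by erw [h, zero_comp])

/-- The restriction of the adjoint transpose of a resolution of `G M`. -/
def LeftResolution.mapTransposeIso (adj : F ⊣ G) {M : A} (R : LeftResolution P (G.obj M)) :
    (G.mapHomologicalComplex _).obj
      (ChainComplex.augment ((F.mapHomologicalComplex _).obj R.complex) (F.map R.ε ≫ adj.counit.app M)
        (R.d_comp_map_ε_comp_counit adj)) ≅ R.augmented :=
  mapAugmentIso G (unitMapIso adj R.complex) (Iso.refl _) (by
    change G.map (F.map R.ε ≫ adj.counit.app M) ≫ 𝟙 _ =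
      inv (adj.unit.app (R.complex.X 0)) ≫ R.ε
    rw [comp_id, IsIso.eq_inv_comp, G.map_comp]
    exact (adj.unit_naturality_assoc R.ε _).trans (by simp))

/-- The adjoint transpose of a left resolution of `G M`. -/
def LeftResolution.transpose (adj : F ⊣ G) {M : A} (R : LeftResolution P (G.obj M)) :
    LeftResolution (P.map F) M where
  complex := (F.mapHomologicalComplex _).obj R.complex
  ε := F.map R.ε ≫ adj.counit.app M
  d_ε := R.d_comp_map_ε_comp_counit adj
  mem i := P.prop_map_obj F (R.mem i)
  rightAcyclic := (rightAcyclic_map_iff adj P _).2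
    (rightAcyclic_of_iso (R.mapTransposeIso adj).symm R.rightAcyclic)

/-- The image of a left resolution under a fully faithful left adjoint. -/
def LeftResolution.map (adj : F ⊣ G) {T : B} (R : LeftResolution P T) :
    LeftResolution (P.map F) (F.obj T) where
  complex := (F.mapHomologicalComplex _).obj R.complex
  ε := F.map R.ε
  d_ε := (F.map_comp _ _).symm.trans (by rw [R.d_ε]; exact F.map_zero _ _)
  mem i := P.prop_map_obj F (R.mem i)
  rightAcyclic := rightAcyclic_of_iso
    (mapAugmentIso F (Iso.refl _) (Iso.refl _) ((comp_id _).trans (id_comp _).symm))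
    (R.rightAcyclic.map adj)

lemma HasRelDimLE.map (adj : F ⊣ G) [PreservesFiniteLimits F] [PreservesFiniteColimits F]
    {T : B} {n : ℕ} (h : HasRelDimLE P T n) : HasRelDimLE (P.map F) (F.obj T) n := by
  obtain ⟨R, hR, hn⟩ := h
  refine ⟨R.map adj, fun i => ?_, fun i hi => F.map_isZero (hn i hi)⟩
  exact (acyclic_map F hR i).of_iso
    (mapAugmentIso F (Iso.refl _) (Iso.refl _) ((comp_id _).trans (id_comp _).symm))

/-- The restriction of a left resolution of `F T` with terms in the image of `F`. -/
def LeftResolution.restrict (adj : F ⊣ G) (hP : IsAdditiveSubcategory P) {T : B}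
    (R : LeftResolution (P.map F) (F.obj T)) : LeftResolution P T where
  complex := (G.mapHomologicalComplex _).obj R.complex
  ε := G.map R.ε ≫ inv (adj.unit.app T)
  d_ε := (assoc _ _ _).symm.trans (by
    have h : G.map (R.complex.d 1 0) ≫ G.map R.ε = 0 := by rw [← G.map_comp, R.d_ε, G.map_zero]
    erw [h, zero_comp])
  mem i := by
    obtain ⟨D, hD, ⟨e⟩⟩ := R.mem i
    exact hP.of_iso (asIso (adj.unit.app D) ≪≫ G.mapIso e) hD
  rightAcyclic := rightAcyclic_of_iso
    (mapAugmentIso G (Iso.refl _) (asIso (adj.unit.app T)).symm (id_comp _).symm)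
    ((rightAcyclic_map_iff adj P _).1 R.rightAcyclic)

lemma RelExtVanishes.map (adj : F ⊣ G) (hP : IsAdditiveSubcategory P) {T : B} {N : A} {i : ℕ}
    (h : RelExtVanishes P T (G.obj N) i) : RelExtVanishes (P.map F) (F.obj T) N i := by
  intro R
  have hR := h (R.restrict adj hP)
  rw [LeftResolution.ext, ← HomologicalComplex.exactAt_iff_isZero_homology] at hR ⊢
  refine ((homTo_map_exactAt_iff adj _ N i).1 hR).of_iso
    (((preadditiveYoneda.obj N).mapHomologicalComplex _).mapIso
      ((HomologicalComplex.opFunctor A _).mapIso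
        (counitMapIsoOfMem adj R.complex fun j => ?_).symm.op))
  obtain ⟨D, -, ⟨e⟩⟩ := R.mem j
  exact ⟨D, ⟨e⟩⟩

omit [G.Additive] [F.Full] [F.Faithful] in
lemma InAdd.map (adj : F ⊣ G) {T K : B} (h : InAdd.{w} T K) : InAdd.{w} (F.obj T) (F.obj K) := by
  obtain ⟨I, c, J, ⟨hc⟩, ⟨e⟩⟩ := h
  have := adj.leftAdjoint_preservesColimits
  have := preservesBinaryBiproducts_of_preservesBiproducts F
  exact ⟨I, Cofan.mk (F.obj c.pt) fun i => F.map (c.inj i), F.obj J,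
    ⟨isColimitCofanMkObjOfIsColimit F _ _ (hc.ofIsoColimit (Cofan.ext (Iso.refl _)))⟩,
    ⟨(F.mapBiprod K J).symm ≪≫ F.mapIso e⟩⟩

omit [H.Additive] in
lemma IsSelfOrthogonal.map (adj : F ⊣ G) (adj' : G ⊣ H) (hP : IsAdditiveSubcategory P) {T : B}
    (h : IsSelfOrthogonal.{w} P T) : IsSelfOrthogonal.{w} (P.map F) (F.obj T) := by
  rintro I c ⟨hc⟩ i hi
  have := adj'.leftAdjoint_preservesColimits
  let e : (Discrete.functor fun _ : I => T) ≅ Discrete.functor fun _ : I => G.obj (F.obj T) :=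
    Discrete.natIso fun _ => asIso (adj.unit.app T)
  have hc' := isColimitCofanMkObjOfIsColimit G _ _
    (hc.ofIsoColimit (Cofan.ext (c₂ := Cofan.mk c.pt c.inj) (Iso.refl _)))
  exact (h I ((Cocone.precompose e.hom).obj (Cofan.mk (G.obj c.pt) fun i => G.map (c.inj i)))
    ⟨(IsColimit.precomposeHomEquiv e _).symm hc'⟩ i hi).map adj hP

lemma HasAddCoresolution.map (adj : F ⊣ G) [PreservesFiniteLimits F] [PreservesFiniteColimits F]
    {T M : B} {n : ℕ} (h : HasAddCoresolution.{w} P T n M) {N : A} (e : F.obj M ≅ N) :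
    HasAddCoresolution.{w} (P.map F) (F.obj T) n N := by
  obtain ⟨L, η, hη, hL, hAdd, hn⟩ := h
  have hη' : F.map η ≫ F.map (L.d 0 1) = 0 := by rw [← F.map_comp, hη, F.map_zero]
  have hη'' : (e.inv ≫ F.map η) ≫ F.map (L.d 0 1) = 0 := by rw [assoc, hη', comp_zero]
  let e' := mapCoaugmentIso F (K := L) (hη := hη) (η' := e.inv ≫ F.map η) (hη' := hη'')
    (Iso.refl _) e ((comp_id _).trans (e.hom_inv_id_assoc _).symm)
  exact ⟨(F.mapHomologicalComplex _).obj L, e.inv ≫ F.map η, hη'',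
    ⟨fun i => (acyclic_map F hL.1 i).of_iso e', rightAcyclic_of_iso e' (hL.2.map adj)⟩,
    fun i hi => (hAdd i hi).map adj, fun i hi => F.map_isZero (hn i hi)⟩

omit [H.Additive] in
lemma IsTilting.map (adj : F ⊣ G) (adj' : G ⊣ H) [PreservesFiniteLimits F]
    [PreservesFiniteColimits F] (hP : IsAdditiveSubcategory P) {T : B} {n : ℕ}
    (h : IsTilting.{w} P n T) : IsTilting.{w} (P.map F) n (F.obj T) where
  dim_le := h.dim_le.map adj
  selfOrthogonal := h.selfOrthogonal.map adj adj' hP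
  coresolution := by
    rintro M ⟨D, hD, ⟨e⟩⟩
    exact (h.coresolution D hD).map adj e

omit [Abelian A] [F.Additive] [G.Additive] in
lemma IsAdmissible.map (adj : F ⊣ G) [G.Faithful] (hP : IsAdditiveSubcategory P)
    (h : IsAdmissible P) : IsAdmissible (P.map F) := by
  refine ⟨h.1.map adj, ?_⟩
  rintro C M f ⟨⟨D, hD, ⟨e⟩⟩, hf⟩
  have : Epi (G.map f) := h.2 _
    ⟨hP.of_iso (asIso (adj.unit.app D) ≪≫ G.mapIso e) hD, fun C' hC' g => by
      obtain ⟨k, hk⟩ := hf _ (P.prop_map_obj F hC') ((adj.homEquiv _ _).symm g)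
      exact ⟨adj.homEquiv _ _ k, by
        rw [← adj.homEquiv_naturality_right, hk, Equiv.apply_symm_apply]⟩⟩
  exact G.epi_of_epi_map this

end

variable [H.Full] [H.Faithful]

omit [G.Additive] [H.Full] [H.Faithful] in
lemma RightCoresolution.unit_comp_map_η_comp_d (adj : G ⊣ H) {M : A}
    (R : RightCoresolution P (G.obj M)) :
    (adj.unit.app M ≫ H.map R.η) ≫ ((H.mapHomologicalComplex _).obj R.complex).d 0 1 = 0 := by
  have h : H.map R.η ≫ H.map (R.complex.d 0 1) = 0 := by rw [← H.map_comp, R.η_d, H.map_zero]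
  exact (assoc _ _ _).trans (by erw [h, comp_zero])

/-- The restriction of the adjoint transpose of a coresolution of `G M`. -/
def RightCoresolution.mapTransposeIso (adj : G ⊣ H) {M : A} (R : RightCoresolution P (G.obj M)) :
    (G.mapHomologicalComplex _).obj
      (CochainComplex.augment ((H.mapHomologicalComplex _).obj R.complex) (adj.unit.app M ≫ H.map R.η)
        (R.unit_comp_map_η_comp_d adj)) ≅ R.augmented :=
  mapCoaugmentIso G (counitMapIso adj R.complex) (Iso.refl _) (by
    change G.map (adj.unit.app M ≫ H.map R.η) ≫ adj.counit.app (R.complex.X 0) = 𝟙 _ ≫ R.η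
    simp)

/-- The adjoint transpose of a right coresolution of `G M`. -/
def RightCoresolution.transpose (adj : G ⊣ H) {M : A} (R : RightCoresolution P (G.obj M)) :
    RightCoresolution (P.map H) M where
  complex := (H.mapHomologicalComplex _).obj R.complex
  η := adj.unit.app M ≫ H.map R.η
  η_d := R.unit_comp_map_η_comp_d adj
  mem i := P.prop_map_obj H (R.mem i)
  leftAcyclic := (leftAcyclic_map_iff adj P _).2
    (leftAcyclic_of_iso (R.mapTransposeIso adj).symm R.leftAcyclic)

/-- Balanced pairs are transported along an adjoint triple with fully faithful outer functors. -/
lemma IsBalancedPair.map (adj : F ⊣ G) (adj' : G ⊣ H) [F.Full] [F.Faithful]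
    {Q : ObjectProperty B} (h : IsBalancedPair P Q) : IsBalancedPair (P.map F) (Q.map H) where
  additive_left := h.additive_left.map F
  additive_right := h.additive_right.map H
  contravariantlyFinite := h.contravariantlyFinite.map adj
  covariantlyFinite := h.covariantlyFinite.map adj'
  exists_resolution M := by
    obtain ⟨R, hR⟩ := h.exists_resolution (G.obj M)
    exact ⟨R.transpose adj, (leftAcyclic_map_iff adj' Q _).2
      (leftAcyclic_of_iso (R.mapTransposeIso adj).symm hR)⟩
  exists_coresolution M := by
    obtain ⟨R, hR⟩ := h.exists_coresolution (G.obj M)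
    exact ⟨R.transpose adj', (rightAcyclic_map_iff adj P _).2
      (rightAcyclic_of_iso (R.mapTransposeIso adj').symm hR)⟩

end Resolutions

end Transport

section Recollements

variable {A' : Type u₁} [Category.{v₁} A'] [Abelian A']
  {A : Type u₂} [Category.{v₂} A] [Abelian A]
  {A'' : Type u₃} [Category.{v₃} A''] [Abelian A'']

lemma Recollement.isZero_jUpperStar_iLowerStar (R : Recollement A' A A'') (M : A') :
    IsZero (R.jUpperStar.obj (R.iLowerStar.obj M)) :=
  (R.essImage_iff _).1 (R.iLowerStar.obj_mem_essImage M)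

lemma Recollement.isZero_iUpperStar_jLowerShriek (R : Recollement A' A A'') (M : A'') :
    IsZero (R.iUpperStar.obj (R.jLowerShriek.obj M)) := by
  rw [IsZero.iff_id_eq_zero]
  apply (R.adj_i₁.homEquiv _ _).injective
  apply (R.adj_j₁.homEquiv _ _).injective
  exact (R.isZero_jUpperStar_iLowerStar _).eq_of_tgt _ _

lemma Recollement.isZero_iUpperShriek_jLowerStar (R : Recollement A' A A'') (M : A'') :
    IsZero (R.iUpperShriek.obj (R.jLowerStar.obj M)) := by
  rw [IsZero.iff_id_eq_zero]
  apply (R.adj_i₂.homEquiv _ _).symm.injective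
  apply (R.adj_j₂.homEquiv _ _).symm.injective
  exact (R.isZero_jUpperStar_iLowerStar _).eq_of_src _ _

lemma IsAdditiveSubcategory.of_isZero {P : ObjectProperty A} (hP : IsAdditiveSubcategory P)
    {M : A} (hM : IsZero M) : P M := by
  obtain ⟨Z, hZ, hPZ⟩ := hP.exists_zero
  exact hP.of_iso (hZ.iso hM) hPZ

lemma Recollement.subU_glueX (R : Recollement A' A A'') {X' : ObjectProperty A'}
    {X'' : ObjectProperty A''} (h' : IsAdditiveSubcategory X') (h'' : IsAdditiveSubcategory X'') :
    R.subU (R.glueX X' X'') = X''.map R.jLowerShriek := by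
  have := R.full_jLowerShriek
  have := R.faithful_jLowerShriek
  apply le_antisymm
  · rintro M ⟨D, ⟨N, hN, ⟨e⟩⟩, e'⟩
    exact ⟨D, h''.of_iso e hN.2, e'⟩
  · rintro M ⟨D, hD, e⟩
    exact ⟨D, ⟨R.jLowerShriek.obj D,
      ⟨h'.of_isZero (R.isZero_iUpperStar_jLowerShriek D),
        h''.of_iso (asIso (R.adj_j₁.unit.app D)) hD⟩,
      ⟨(asIso (R.adj_j₁.unit.app D)).symm⟩⟩, e⟩

lemma Recollement.subV_glueY (R : Recollement A' A A'') {Y' : ObjectProperty A'}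
    {Y'' : ObjectProperty A''} (h' : IsAdditiveSubcategory Y') (h'' : IsAdditiveSubcategory Y'') :
    R.subV (R.glueY Y' Y'') = Y''.map R.jLowerStar := by
  have := R.full_jLowerStar
  have := R.faithful_jLowerStar
  apply le_antisymm
  · rintro M ⟨D, ⟨N, hN, ⟨e⟩⟩, e'⟩
    exact ⟨D, h''.of_iso e hN.2, e'⟩
  · rintro M ⟨D, hD, e⟩
    exact ⟨D, ⟨R.jLowerStar.obj D,
      ⟨h'.of_isZero (R.isZero_iUpperShriek_jLowerStar D),
        h''.of_iso (asIso (R.adj_j₂.counit.app D)).symm hD⟩,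
      ⟨asIso (R.adj_j₂.counit.app D)⟩⟩, e⟩

end Recollements

end RelTilting

end

theorem theorem4p3
    {A' : Type u₁} [Category.{v₁} A'] [Abelian A']
    {A : Type u₂} [Category.{v₂} A] [Abelian A]
    {A'' : Type u₃} [Category.{v₃} A''] [Abelian A'']
    (R : RelTilting.Recollement A' A A'')
    (X' Y' : ObjectProperty A') (X'' Y'' : ObjectProperty A'')
    (h' : RelTilting.IsBalancedPair X' Y')
    (h'' : RelTilting.IsBalancedPair X'' Y'')
    (hj : exactFunctor A'' A R.jLowerShriek)
    (n : ℕ) (T'' : A'')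
    (hT : RelTilting.IsTilting.{w} X'' n T'') :
    RelTilting.IsBalancedPair (R.subU (R.glueX X' X'')) (R.subV (R.glueY Y' Y'')) ∧
    RelTilting.IsTilting.{w} (R.subU (R.glueX X' X'')) n (R.jLowerShriek.obj T'') ∧
    (RelTilting.IsAdmissible X'' → R.jUpperStar.Faithful →
      RelTilting.IsAdmissible (R.subU (R.glueX X' X''))) := by
  have := R.additive_jLowerShriek
  have := R.additive_jUpperStar
  have := R.additive_jLowerStar
  have := R.full_jLowerShriek
  have := R.faithful_jLowerShriek
  have := R.full_jLowerStar
  have := R.faithful_jLowerStar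
  obtain ⟨_, _⟩ := (exactFunctor_iff R.jLowerShriek).1 hj
  rw [R.subU_glueX h'.additive_left h''.additive_left,
    R.subV_glueY h'.additive_right h''.additive_right]
  exact ⟨h''.map R.adj_j₁ R.adj_j₂, hT.map R.adj_j₁ R.adj_j₂ h''.additive_left,
    fun h _ => h.map R.adj_j₁ h''.additive_left⟩
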